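/- Let $\mathsf h\neq\{0\}$ be a finite-dimensional complex Hilbert space, $\mathcal B(\mathsf h)$ the algebra of all linear operators on it, and let $\mathcal T=(\mathcal T_t)_{t\ge 0}$ be a quantum Markov semigroup on $\mathcal B(\mathsf h)$, i.e. a (weak$^*$-)continuous semigroup ($\mathcal T_0=\mathrm{id}$, $\mathcal T_{s+t}=\mathcal T_s\mathcal T_t$) of completely positive linear maps with $\mathcal T_t(\mathbf 1)=\mathbf 1$. Let $\mathcal L=\lim_{t\to0^+}(\mathcal T_t-\mathrm{id})/t$ be its generator, $\sigma(\mathcal L)$ the spectrum of $\mathcal L$, and $\mathcal T_{*t}$ the predual maps, defined by $\operatorname{tr}(\mathcal T_{*t}(\eta)x)=\operatorname{tr}(\eta\,\mathcal T_t(x))$ for all $\eta,x\in\mathcal B(\mathsf h)$. A density is a positive operator of trace $1$; it is faithful if its range is all of $\mathsf h$, and invariant if $\mathcal T_{*t}(\rho)=\rho$ for all $t\ge0$. A completely positive map $\Phi$ is irreducible if the only orthogonal projections $p$ with $\Phi(p)\ge p$ are $0$ and $\mathbf 1$. The semigroup $\mathcal T$ is - irreducible if the only orthogonal projections $p$ with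 $\mathcal T_t(p)\ge p$ for all $t\ge 0$ are $0$ and $\mathbf 1$; - primitive if it has a unique invariant density and this density is faithful; - ergodic if for every density $\eta$ there is a density $\rho$ with $\lim_{t\to+\infty}\mathcal T_{*t}(\eta)=\rho$ in trace norm; - positivity improving if $x\ge 0$, $x\ne 0$ implies $\mathcal T_t(x)>0$ (positive and invertible) for all $t>0$. Then the following are equivalent: 1. $\mathcal T$ is irreducible; 2. $\mathcal T$ is primitive; 3. $\mathcal T_{t_0}$ is irreducible for all $t_0>0$; 4. $\mathcal T_{t_0}$ is irreducible for some $t_0>0$; 5. $\mathcal T$ is primitive and $\sigma(\mathcal L)\cap \mathrm i\mathbb R=\{0\}$; 6. (a) $\mathcal T$ is ergodic and every limit density is faithful; or, equivalently, (b) there is one faithful density $\rho$ such that $\lim_{t\to+\infty}\mathcal T_{*t}(\eta)=\rho$ in trace norm for every density $\eta$; 7. $\mathcal T$ is positivity improving. -/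

import Mathlib

open scoped NNReal CStarAlgebra InnerProductSpace

/-! Throughout, `H` is a finite-dimensional complex Hilbert space and `H →L[ℂ] H` is the algebra
of all operators on it, with its Loewner order. Every operator on `H` is trace class. -/

noncomputable section

namespace Quantum

variable {H : Type*} [NormedAddCommGroup H] [InnerProductSpace ℂ H] [CompleteSpace H]
  [FiniteDimensional ℂ H]

/-- The trace of an operator. -/
def tr (x : H →L[ℂ] H) : ℂ := LinearMap.trace ℂ H (x : H →ₗ[ℂ] H)

theorem tr_rankOne_mul (u v : H) (x : H →L[ℂ] H) :
    tr (InnerProductSpace.rankOne ℂ v u * x) = ⟪u, x v⟫_ℂ := by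
  have h := LinearMap.trace_mul_comm ℂ
    ((InnerProductSpace.rankOne ℂ v u : H →L[ℂ] H) : H →ₗ[ℂ] H) (x : H →ₗ[ℂ] H)
  have h' : tr (InnerProductSpace.rankOne ℂ v u * x)
      = tr (x * InnerProductSpace.rankOne ℂ v u) := h
  rw [h', ContinuousLinearMap.mul_def, InnerProductSpace.comp_rankOne]
  exact InnerProductSpace.trace_rankOne _ _

/-- The trace norm `tr |x|`, with `|x| = (x* x)^{1/2}`. -/
def traceNorm (x : H →L[ℂ] H) : ℝ := (tr (CFC.abs x)).re

/-- The trace duality `(η, x) ↦ tr (η x)` as a bilinear form. -/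
def traceForm (H : Type*) [NormedAddCommGroup H] [InnerProductSpace ℂ H]
    [FiniteDimensional ℂ H] : LinearMap.BilinForm ℂ (H →L[ℂ] H) :=
  LinearMap.mk₂ ℂ (fun η x => tr (η * x))
    (fun a b x => by simp [tr, add_mul])
    (fun c a x => by simp [tr])
    (fun a x y => by simp [tr, mul_add])
    (fun c a x => by simp [tr])

theorem tr_mul_comm (x y : H →L[ℂ] H) : tr (x * y) = tr (y * x) :=
  LinearMap.trace_mul_comm ℂ (x : H →ₗ[ℂ] H) (y : H →ₗ[ℂ] H)

theorem eq_zero_of_tr (x : H →L[ℂ] H) (h : ∀ η : H →L[ℂ] H, tr (η * x) = 0) : x = 0 := by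
  ext v
  refine ext_inner_left ℂ fun u => ?_
  rw [← tr_rankOne_mul, h]
  simp

theorem traceForm_nondegenerate : (traceForm H).Nondegenerate := by
  refine ⟨fun x hx => eq_zero_of_tr x fun η => ?_, fun x hx => eq_zero_of_tr x fun η => hx η⟩
  rw [tr_mul_comm]
  exact hx η

/-- The predual `Φ_*` of a linear map `Φ` on operators: the unique linear map such that
`tr (Φ_* η · x) = tr (η · Φ x)` for all `η` and `x`. -/
def predual (Φ : (H →L[ℂ] H) →ₗ[ℂ] (H →L[ℂ] H)) : (H →L[ℂ] H) →ₗ[ℂ] (H →L[ℂ] H) :=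
  (traceForm H).leftAdjointOfNondegenerate traceForm_nondegenerate Φ

theorem tr_predual_mul (Φ : (H →L[ℂ] H) →ₗ[ℂ] (H →L[ℂ] H)) (η x : H →L[ℂ] H) :
    tr (predual Φ η * x) = tr (η * Φ x) :=
  LinearMap.BilinForm.isAdjointPairLeftAdjointOfNondegenerate (traceForm H)
    traceForm_nondegenerate Φ η x

/-- A density: a positive operator of unit trace. -/
def IsDensity (ρ : H →L[ℂ] H) : Prop := 0 ≤ ρ ∧ tr ρ = 1

/-- The support of an operator: the closure of its range. -/
def support (ρ : H →L[ℂ] H) : Submodule ℂ H := (LinearMap.range (ρ : H →ₗ[ℂ] H)).topologicalClosure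

/-- A density is faithful if its support is the whole space. -/
def IsFaithful (ρ : H →L[ℂ] H) : Prop := support ρ = ⊤

/-- A completely positive map is irreducible if it has no non-trivial subharmonic projection. -/
def IsIrreducibleMap (Φ : (H →L[ℂ] H) →CP (H →L[ℂ] H)) : Prop :=
  ∀ p : H →L[ℂ] H, IsStarProjection p → p ≤ Φ p → p = 0 ∨ p = 1

/-- A norm continuous semigroup of operators on a Banach space is differentiable at `0`. -/
theorem exists_hasDerivWithinAt_of_semigroup {E : Type*} [NormedAddCommGroup E]
    [NormedSpace ℂ E] [CompleteSpace E] (S : ℝ → (E →L[ℂ] E)) (hSc : Continuous S)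
    (hS0 : S 0 = 1) (hSadd : ∀ s t : ℝ, 0 ≤ s → 0 ≤ t → S (s + t) = S s * S t) :
    ∃ L : E →L[ℂ] E, ∀ x, HasDerivWithinAt (fun t => S t x) (L x) (Set.Ici 0) 0 := by
  let F : ℝ → (E →L[ℂ] E) := fun t => ∫ s in (0 : ℝ)..t, S s
  have hF : ∀ t, HasDerivAt F (S t) t := fun t => hSc.integral_hasStrictDerivAt 0 t |>.hasDerivAt
  have hF0 : F 0 = 0 := by simp [F]
  -- some `F a` is invertible
  obtain ⟨a, ha, u, hu⟩ : ∃ a : ℝ, 0 < a ∧ IsUnit (F a) := by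
    have h1 := (hF 0).tendsto_slope_zero_right
    rw [hS0] at h1
    have h2 := h1.eventually (Units.isOpen.mem_nhds (isUnit_one : IsUnit (1 : E →L[ℂ] E)))
    obtain ⟨a, ha, ha0⟩ := (h2.and self_mem_nhdsWithin).exists
    have ha0' : (0 : ℝ) < a := ha0
    refine ⟨a, ha0', ?_⟩
    have ha' : IsUnit (a⁻¹ • F a) := by simpa [hF0] using ha
    have h3 := ha'.smul (Units.mk0 a ha0'.ne')
    rwa [Units.smul_mk0, smul_inv_smul₀ ha0'.ne'] at h3
  have hkey : ∀ t : ℝ, 0 ≤ t → S t = (F (t + a) - F t) * ↑u⁻¹ := by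
    intro t ht
    have h1 : S t * F a = F (t + a) - F t := by
      have e1 : F (t + a) - F t = ∫ s in t..(t + a), S s :=
        intervalIntegral.integral_interval_sub_left
          (hSc.intervalIntegrable _ _) (hSc.intervalIntegrable _ _)
      have e2 : ∫ s in t..(t + a), S s = ∫ s in (0 : ℝ)..a, S (t + s) := by
        rw [intervalIntegral.integral_comp_add_left (fun s => S s) t, add_zero]
      have e3 : ∫ s in (0 : ℝ)..a, S (t + s) = ∫ s in (0 : ℝ)..a, S t * S s := by
        refine intervalIntegral.integral_congr fun s hs => ?_
        rw [Set.uIcc_of_le ha.le] at hs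
        exact hSadd t s ht hs.1
      rw [e1, e2, e3]
      exact (((ContinuousLinearMap.mul ℂ (E →L[ℂ] E))
        (S t)).intervalIntegral_comp_comm (hSc.intervalIntegrable 0 a)).symm
    rw [← h1, ← hu, mul_assoc, Units.mul_inv, mul_one]
  have hd : HasDerivWithinAt S ((S (0 + a) - S 0) * ↑u⁻¹) (Set.Ici 0) 0 := by
    have h1 : HasDerivAt (fun t => (F (t + a) - F t) * ((u⁻¹ : (E →L[ℂ] E)ˣ) : E →L[ℂ] E))
        ((S (0 + a) - S 0) * ↑u⁻¹) 0 :=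
      (((hF (0 + a)).comp_add_const 0 a).sub (hF 0)).mul_const _
    exact h1.hasDerivWithinAt.congr (fun t ht => hkey t ht) (hkey 0 le_rfl)
  refine ⟨(S (0 + a) - S 0) * ↑u⁻¹, fun x => ?_⟩
  exact ((ContinuousLinearMap.apply ℂ E x).restrictScalars
    ℝ).hasFDerivAt.comp_hasDerivWithinAt 0 hd

end Quantum

open Quantum

/-- A quantum Markov semigroup on the operators of a finite-dimensional Hilbert space: a weak*
continuous one-parameter semigroup of completely positive, identity preserving maps.
Normality of the maps holds for every linear map here (see `Quantum.tr_predual_mul`). -/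
structure QMS (H : Type*) [NormedAddCommGroup H] [InnerProductSpace ℂ H] [CompleteSpace H]
    [FiniteDimensional ℂ H] where
  /-- The map at time `t`. -/
  map : ℝ≥0 → ((H →L[ℂ] H) →CP (H →L[ℂ] H))
  map_zero : ∀ x, map 0 x = x
  map_add : ∀ s t x, map (s + t) x = map s (map t x)
  map_one : ∀ t, map t 1 = 1
  weakStar_continuous : ∀ η x : H →L[ℂ] H, Continuous fun t => tr (η * map t x)

namespace QMS

variable {H : Type*} [NormedAddCommGroup H] [InnerProductSpace ℂ H] [CompleteSpace H]
  [FiniteDimensional ℂ H] (T : QMS H)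

/-- The predual semigroup. -/
def predual (t : ℝ≥0) : (H →L[ℂ] H) →ₗ[ℂ] (H →L[ℂ] H) :=
  Quantum.predual (T.map t).toLinearMap

theorem continuous_map_apply (x : H →L[ℂ] H) : Continuous fun t => T.map t x := by
  rw [continuous_clm_apply]
  intro v
  have h : (fun t => T.map t x v) = fun t => ∑ i, ⟪stdOrthonormalBasis ℂ H i, T.map t x v⟫_ℂ •
      stdOrthonormalBasis ℂ H i := by
    funext t
    exact ((stdOrthonormalBasis ℂ H).sum_repr' _).symm
  rw [h]
  refine continuous_finsetSum _ fun i _ => Continuous.smul ?_ continuous_const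
  simp_rw [← tr_rankOne_mul]
  exact T.weakStar_continuous _ x

/-- A weak* continuous semigroup on a finite-dimensional space is differentiable at `0`. -/
theorem exists_generator : ∃ L : Module.End ℂ (H →L[ℂ] H), ∀ x : H →L[ℂ] H,
    HasDerivWithinAt (fun t : ℝ => T.map t.toNNReal x) (L x) (Set.Ici 0) 0 := by
  obtain ⟨L, hL⟩ := exists_hasDerivWithinAt_of_semigroup (fun t : ℝ =>
    LinearMap.toContinuousLinearMap (T.map t.toNNReal).toLinearMap)
    (by
      rw [continuous_clm_apply]
      intro x
      exact (T.continuous_map_apply x).comp continuous_real_toNNReal)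
    (by
      ext1 x
      change T.map (Real.toNNReal 0) x = x
      rw [Real.toNNReal_zero, T.map_zero])
    (by
      intro s t hs ht
      ext1 x
      change T.map (Real.toNNReal (s + t)) x = T.map s.toNNReal (T.map t.toNNReal x)
      rw [Real.toNNReal_add hs ht, T.map_add])
  exact ⟨(L : (H →L[ℂ] H) →ₗ[ℂ] (H →L[ℂ] H)), hL⟩

/-- The generator `𝓛` of the semigroup, `𝓛 x = lim_{t → 0+} (𝓣_t x - x) / t`; see
`QMS.hasDerivWithinAt_generator`. -/
def generator : Module.End ℂ (H →L[ℂ] H) := T.exists_generator.choose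

theorem hasDerivWithinAt_generator (x : H →L[ℂ] H) :
    HasDerivWithinAt (fun t : ℝ => T.map t.toNNReal x) (T.generator x) (Set.Ici 0) 0 :=
  T.exists_generator.choose_spec x

/-- The semigroup is irreducible if its maps have no non-trivial common subharmonic projection. -/
def IsIrreducible : Prop :=
  ∀ p : H →L[ℂ] H, IsStarProjection p → (∀ t, p ≤ T.map t p) → p = 0 ∨ p = 1

/-- An invariant density. -/
def IsInvariantDensity (ρ : H →L[ℂ] H) : Prop := IsDensity ρ ∧ ∀ t, T.predual t ρ = ρ

/-- The semigroup is primitive if it has a unique invariant density and this is faithful. -/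
def IsPrimitive : Prop :=
  ∃ ρ, T.IsInvariantDensity ρ ∧ IsFaithful ρ ∧ ∀ ρ', T.IsInvariantDensity ρ' → ρ' = ρ

/-- The evolution of `η` under the predual semigroup converges to `ρ` in trace norm. -/
def RelaxesTo (η ρ : H →L[ℂ] H) : Prop :=
  Filter.Tendsto (fun t => traceNorm (T.predual t η - ρ)) Filter.atTop (nhds 0)

/-- The semigroup is ergodic (relaxing) if the evolution of every density converges, in trace
norm, to a density. -/
def IsErgodic : Prop := ∀ η, IsDensity η → ∃ ρ, IsDensity ρ ∧ T.RelaxesTo η ρ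

/-- The semigroup is positivity improving: `x ≥ 0`, `x ≠ 0` and `t > 0` imply `𝓣_t x > 0`,
that is, `𝓣_t x` is positive and invertible. -/
def IsPositivityImproving : Prop :=
  ∀ x : H →L[ℂ] H, 0 ≤ x → x ≠ 0 → ∀ t : ℝ≥0, 0 < t → IsStrictlyPositive (T.map t x)

end QMS

end

/-! An invariant density `ρ` has a subharmonic support projection, so irreducibility makes every
invariant density faithful, and then there is only one: the line through two of them would leave
the positive cone at a singular density. For a unique faithful `ρ`, the Kadison–Schwarz inequality
shows that the eigenvectors of the generator for imaginary eigenvalues are non-zero multiples of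
isometries in the multiplicative domain of the semigroup. Their powers are eigenvectors too, so
finite dimension leaves only the eigenvalue `0`, whose fixed points are the scalars by the
Markov–Kakutani theorem. Hence `𝓣_1 - tr (ρ ·) 1` has spectral radius less than `1`, and
`𝓣_t x → tr (ρ x) 1`. For `x ≥ 0`, `x ≠ 0` the limit is invertible, and analyticity of
`t ↦ det (𝓣_t x)` carries invertibility back to every `t > 0`. -/

open Filter Topology Quantum
open scoped ComplexOrder

section OrderedModule

variable {E : Type*} [AddCommGroup E] [PartialOrder E] [Module ℝ E] [PosSMulMono ℝ E]
  [TopologicalSpace E] [ClosedIciTopology E] [ContinuousAdd E] [ContinuousSMul ℝ E] {a δ : E}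

theorem nonneg_of_eventually_nonneg_add_smul (h : ∀ᶠ s : ℝ in atTop, 0 ≤ a + s • δ) : 0 ≤ δ := by
  have hlim : Tendsto (fun s : ℝ => s⁻¹ • a + δ) atTop (𝓝 δ) := by
    simpa using ((tendsto_inv_atTop_zero (𝕜 := ℝ)).smul_const a).add_const δ
  refine ge_of_tendsto hlim ?_
  filter_upwards [h, eventually_gt_atTop 0] with s hs hs0
  simpa [smul_add, smul_smul, hs0.ne'] using smul_nonneg (inv_nonneg.2 hs0.le) hs

theorem eq_zero_of_forall_nonneg_add_smul [IsOrderedAddMonoid E] (h : ∀ s : ℝ, 0 ≤ a + s • δ) :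
    δ = 0 := by
  refine le_antisymm (neg_nonneg.1 ?_) (nonneg_of_eventually_nonneg_add_smul (.of_forall h))
  exact nonneg_of_eventually_nonneg_add_smul (a := a) (.of_forall fun s => by simpa using h (-s))

end OrderedModule

section CStarAlgebra

variable {A B : Type*} [CStarAlgebra A] [PartialOrder A] [StarOrderedRing A]
  [CStarAlgebra B] [PartialOrder B] [StarOrderedRing B]

theorem exists_pos_algebraMap_le_of_isStrictlyPositive [Nontrivial A] {a : A}
    (ha : IsStrictlyPositive a) : ∃ ε > 0, algebraMap ℝ A ε ≤ a :=
  (CFC.exists_pos_algebraMap_le_iff ha.isSelfAdjoint).2 fun _ => ha.spectrum_pos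

theorem eventually_nonneg_add_smul {a δ : A} (ha : IsStrictlyPositive a) (hδ : IsSelfAdjoint δ) :
    ∀ᶠ s : ℝ in 𝓝 0, 0 ≤ a + s • δ := by
  nontriviality A
  obtain ⟨ε, hε, hle⟩ := exists_pos_algebraMap_le_of_isStrictlyPositive ha
  have hsmall : ∀ᶠ s : ℝ in 𝓝 0, ‖s • δ‖ < ε :=
    ((continuous_id.smul continuous_const).norm.tendsto' 0 0 (by simp)).eventually_lt_const hε
  filter_upwards [hsmall] with s hs
  have hself : IsSelfAdjoint (s • δ) := .smul (.all s) hδ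
  calc (0 : A) ≤ algebraMap ℝ A ε + -algebraMap ℝ A ‖s • δ‖ := by
        rw [← sub_eq_add_neg, sub_nonneg]
        exact algebraMap_mono A hs.le
    _ ≤ a + s • δ := add_le_add hle hself.neg_algebraMap_norm_le_self

theorem eq_zero_of_forall_isUnit_add_smul {a δ : A} (ha : 0 ≤ a) (hδ : IsSelfAdjoint δ)
    (h : ∀ s : ℝ, 0 ≤ a + s • δ → IsUnit (a + s • δ)) : δ = 0 := by
  let S : Set ℝ := {s | 0 ≤ a + s • δ}
  have hclosed : IsClosed S := isClosed_Ici.preimage (f := fun s : ℝ => a + s • δ) (by fun_prop)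
  have hopen : IsOpen S := isOpen_iff_mem_nhds.2 fun s hs => by
    have hshift : Tendsto (fun r => r - s) (𝓝 s) (𝓝 0) :=
      (continuous_sub_right s).tendsto' s 0 (sub_self s)
    filter_upwards [hshift.eventually (eventually_nonneg_add_smul ⟨hs, h s hs⟩ hδ)] with r hr
    rwa [add_assoc, ← add_smul, add_sub_cancel] at hr
  have huniv : S = Set.univ := IsClopen.eq_univ ⟨hclosed, hopen⟩ ⟨0, by simpa [S] using ha⟩
  exact eq_zero_of_forall_nonneg_add_smul fun s => huniv.ge (Set.mem_univ s)

theorem isStrictlyPositive_map {F : Type*} [FunLike F A B] [LinearMapClass F ℂ A B]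
    [OrderHomClass F A B] {Φ : F} (hΦ : Φ 1 = 1) {a : A} (ha : IsStrictlyPositive a) :
    IsStrictlyPositive (Φ a) := by
  rcases subsingleton_or_nontrivial A with hA | hA
  · rw [Subsingleton.elim a 1, hΦ]
    exact isStrictlyPositive_one
  obtain ⟨ε, hε, hle⟩ := exists_pos_algebraMap_le_of_isStrictlyPositive ha
  have hscalar : Φ (algebraMap ℝ A ε) = algebraMap ℝ B ε := by
    rw [Algebra.algebraMap_eq_smul_one, Algebra.algebraMap_eq_smul_one, ← Complex.coe_smul,
      map_smul, hΦ, Complex.coe_smul]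
  exact (isStrictlyPositive_algebraMap hε).of_le (hscalar ▸ OrderHomClass.mono Φ hle)

theorem apply_self_nonneg_of_nonneg {n A : Type*} [Fintype n] [NonUnitalCStarAlgebra A]
    [PartialOrder A] [StarOrderedRing A] {M : CStarMatrix n n A} (hM : 0 ≤ M) (i : n) :
    0 ≤ M i i := by
  rw [StarOrderedRing.nonneg_iff] at hM
  induction hM using AddSubmonoid.closure_induction with
  | mem M h =>
    obtain ⟨X, rfl⟩ := h
    simp only [CStarMatrix.mul_apply]
    exact Finset.sum_nonneg fun k _ => star_mul_self_nonneg (X k i)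
  | zero => exact le_rfl
  | add M N _ _ hM hN => exact add_nonneg hM hN

theorem le_one_sub_of_mul_eq_zero {b p : A} (hb : b ≤ 1) (hb' : IsSelfAdjoint b)
    (hp : IsStarProjection p) (h : b * p = 0) : b ≤ 1 - p := by
  have hp' : p * b = 0 := by
    rw [← star_star (p * b), star_mul, hp.isSelfAdjoint.star_eq, hb'.star_eq, h, star_zero]
  calc b = star (1 - p) * b * (1 - p) := by
        rw [hp.one_sub.isSelfAdjoint.star_eq, sub_mul, one_mul, hp', sub_zero, mul_sub, h, mul_one,
          sub_zero]
    _ ≤ star (1 - p) * 1 * (1 - p) := star_left_conjugate_le_conjugate hb _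
    _ = 1 - p := by
        rw [mul_one, hp.one_sub.isSelfAdjoint.star_eq, hp.one_sub.isIdempotentElem.eq]

section CompletelyPositive

variable {Φ : A →CP B} (hΦ : Φ 1 = 1)

include hΦ

/-- The Kadison–Schwarz inequality: apply `Φ ⊗ id` to the positive matrix
`[[1, x], [x*, x* x]]` and conjugate by the column `(-Φ x, 1)`. -/
theorem star_map_mul_map_self_le (x : A) : star (Φ x) * Φ x ≤ Φ (star x * x) := by
  let X : CStarMatrix (Fin 2) (Fin 2) A := CStarMatrix.ofMatrix !![1, x; 0, 0]
  let Y : CStarMatrix (Fin 2) (Fin 2) B := CStarMatrix.ofMatrix !![0, -Φ x; 0, 1]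
  have hX := Φ.map_cstarMatrix_nonneg _ (star_mul_self_nonneg X)
  have h := apply_self_nonneg_of_nonneg (star_left_conjugate_nonneg hX Y) 1
  simpa [CStarMatrix.mul_apply, Fin.sum_univ_two, CStarMatrix.star_apply, X, Y, hΦ,
    map_star] using h

theorem norm_map_le_of_map_one (x : A) : ‖Φ x‖ ≤ ‖x‖ := by
  nontriviality B
  refine (sq_le_sq₀ (norm_nonneg _) (norm_nonneg x)).1 ?_
  calc ‖Φ x‖ ^ 2 = ‖star (Φ x) * Φ x‖ := by rw [CStarRing.norm_star_mul_self, sq]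
    _ ≤ ‖Φ (star x * x)‖ :=
        CStarAlgebra.norm_le_norm_of_nonneg_of_le (star_mul_self_nonneg _)
          (star_map_mul_map_self_le hΦ x)
    _ ≤ ‖Φ 1‖ * ‖star x * x‖ :=
        PositiveLinearMap.norm_apply_le_of_nonneg (.ofClass Φ) _ (star_mul_self_nonneg x)
    _ = ‖x‖ ^ 2 := by rw [hΦ, norm_one, one_mul, CStarRing.norm_star_mul_self, sq]

/-- Choi's theorem on the multiplicative domain: the terms linear in `c` of the Schwarz inequality
for `c x + y*` have to vanish. -/
theorem map_mul_of_map_star_mul_self {x : A} (hx : Φ (star x * x) = star (Φ x) * Φ x) (y : A) :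
    Φ (y * x) = Φ y * Φ x := by
  set d := Φ (y * x) - Φ y * Φ x with hd
  set e := Φ (y * star y) - Φ y * star (Φ y) with he
  have hpos (c : ℂ) : 0 ≤ e + (c • d + star (c • d)) := by
    have hstar : star (Φ (y * x)) = Φ (star x * star y) := by rw [← map_star, star_mul]
    refine (sub_nonneg.2 (star_map_mul_map_self_le hΦ (c • x + star y))).trans_eq ?_
    simp only [hd, he, star_add, star_smul, star_star, add_mul, mul_add, map_add, map_smul,
      smul_mul_assoc, mul_smul_comm, map_star, hx, smul_sub, smul_add, star_sub, star_mul, hstar]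
    abel
  have hline (c : ℂ) : c • d + star (c • d) = 0 :=
    eq_zero_of_forall_nonneg_add_smul (a := e) fun s => by
      simpa [mul_smul, smul_add] using hpos (s * c)
  have hadd : d + star d = 0 := by simpa using hline 1
  have hsub : d - star d = 0 := by
    simpa [← smul_neg, ← smul_add, Complex.I_ne_zero, sub_eq_add_neg] using hline Complex.I
  have hzero : d = 0 := by linear_combination (norm := module) (2⁻¹ : ℂ) • hadd + (2⁻¹ : ℂ) • hsub
  exact sub_eq_zero.1 hzero

end CompletelyPositive

end CStarAlgebra

theorem star_smul_mul_smul_self {A : Type*} [NonUnitalNonAssocSemiring A] [StarRing A]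
    [Module ℂ A] [StarModule ℂ A] [IsScalarTower ℂ A A] [SMulCommClass ℂ A A] {z : ℂ}
    (hz : ‖z‖ = 1) (x : A) : star (z • x) * (z • x) = star x * x := by
  have hzz : star z * z = 1 := by simp [Complex.conj_mul', hz]
  rw [star_smul, smul_mul_smul_comm, hzz, one_smul]

section MarkovKakutani

variable {E : Type*} [NormedAddCommGroup E] [NormedSpace ℝ E] {K : Set E}

theorem birkhoffAverage_mem (hK : Convex ℝ K) {f : E → E} (hf : Set.MapsTo f K K) {x : E}
    (hx : x ∈ K) (n : ℕ) : birkhoffAverage ℝ f id (n + 1) x ∈ K := by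
  rw [birkhoffAverage, birkhoffSum, Finset.smul_sum]
  refine hK.sum_mem (fun _ _ => by positivity) ?_ fun k _ => hf.iterate k hx
  rw [Finset.sum_const, Finset.card_range, nsmul_eq_mul, mul_inv_cancel₀ (by positivity)]

theorem exists_fixedPoint_of_mapsTo (hK : IsCompact K) (hconv : Convex ℝ K) (hne : K.Nonempty)
    (f : E →L[ℝ] E) (hf : Set.MapsTo f K K) : ∃ x ∈ K, f x = x := by
  obtain ⟨x, hx⟩ := hne
  obtain ⟨y, hy, φ, hφ, hlim⟩ := hK.tendsto_subseq (birkhoffAverage_mem hconv hf hx)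
  have hbdd : Bornology.IsBounded (Set.range fun n => id (f^[n] x)) :=
    hK.isBounded.subset (Set.range_subset_iff.2 fun n => hf.iterate n hx)
  have hdiff := (tendsto_birkhoffAverage_apply_sub_birkhoffAverage ℝ hbdd).comp
    ((tendsto_add_atTop_nat 1).comp hφ.tendsto_atTop)
  have hcomm (n : ℕ) : birkhoffAverage ℝ f id n (f x) = f (birkhoffAverage ℝ f id n x) := by
    simp only [birkhoffAverage, birkhoffSum, map_smul, map_sum, id,
      ← Function.iterate_succ_apply, Function.iterate_succ_apply']
  refine ⟨y, hy, sub_eq_zero.1 (tendsto_nhds_unique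
    (((f.continuous.tendsto y).comp hlim).sub hlim) (hdiff.congr fun n => ?_))⟩
  simp [hcomm]

/-- Markov–Kakutani: since the maps commute, each of them preserves the fixed points of the
others. -/
theorem exists_common_fixedPoint_of_mapsTo {ι : Type*} (hK : IsCompact K) (hconv : Convex ℝ K)
    (hne : K.Nonempty) (f : ι → E →L[ℝ] E) (hcomm : ∀ i j, Commute (f i) (f j))
    (hf : ∀ i, Set.MapsTo (f i) K K) : ∃ x ∈ K, ∀ i, f i x = x := by
  let F (i : ι) : Set E := {x | f i x = x}
  have hF (i : ι) : IsClosed (F i) := isClosed_eq (f i).continuous continuous_id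
  have hfinite (s : Finset ι) : (K ∩ ⋂ i ∈ s, F i).Nonempty := by
    classical
    induction s using Finset.induction_on with
    | empty => simpa using hne
    | insert i s _ ih =>
      have hconv' : Convex ℝ (K ∩ ⋂ j ∈ s, F j) := hconv.inter <|
        convex_iInter₂ fun j _ => (LinearMap.eqLocus (f j).toLinearMap .id).convex
      have hmaps : Set.MapsTo (f i) (K ∩ ⋂ j ∈ s, F j) (K ∩ ⋂ j ∈ s, F j) := fun x hx => by
        refine ⟨hf i hx.1, Set.mem_iInter₂.2 fun j hj => ?_⟩
        have hxj : f j x = x := Set.mem_iInter₂.1 hx.2 j hj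
        change (f j * f i) x = f i x
        rw [(hcomm j i).eq]
        exact congrArg (f i) hxj
      obtain ⟨x, hx, hxi⟩ := exists_fixedPoint_of_mapsTo
        (hK.inter_right (isClosed_biInter fun j _ => hF j)) hconv' ih (f i) hmaps
      refine ⟨x, hx.1, ?_⟩
      rw [Finset.set_biInter_insert]
      exact ⟨hxi, hx.2⟩
  obtain ⟨x, hxK, hx⟩ := hK.inter_iInter_nonempty F hF hfinite
  exact ⟨x, hxK, fun i => Set.mem_iInter.1 hx i⟩

end MarkovKakutani

theorem sub_pow_succ_of_mul_eq {R : Type*} [Ring R] {a e : R} (he : IsIdempotentElem e)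
    (hae : a * e = e) (hea : e * a = e) (n : ℕ) : (a - e) ^ (n + 1) = a ^ (n + 1) - e := by
  have hpow (k : ℕ) : a ^ k * e = e := by
    induction k with
    | zero => rw [pow_zero, one_mul]
    | succ k ih => rw [pow_succ, mul_assoc, hae, ih]
  induction n with
  | zero => simp
  | succ n ih =>
    rw [pow_succ, ih, sub_mul, mul_sub, mul_sub, hpow, hea, he.eq, sub_self, sub_zero, ← pow_succ]

theorem tendsto_pow_zero_of_spectrum_lt {A : Type*} [NormedRing A] [NormedAlgebra ℂ A]
    [CompleteSpace A] {a : A} (h : ∀ z ∈ spectrum ℂ a, ‖z‖ < 1) :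
    Tendsto (fun n : ℕ => a ^ n) atTop (𝓝 0) := by
  nontriviality A
  have hradius : spectralRadius ℂ a < (1 : ℝ≥0) :=
    spectrum.spectralRadius_lt_of_forall_lt_of_nonempty (spectrum.nonempty a) fun z hz => by
      exact_mod_cast h z hz
  obtain ⟨c, hac, hc1⟩ := ENNReal.lt_iff_exists_nnreal_btwn.1 hradius
  have hc1' : (c : ℝ) < 1 := by exact_mod_cast hc1
  refine squeeze_zero_norm' ?_ (tendsto_pow_atTop_nhds_zero_of_lt_one c.2 hc1')
  filter_upwards [(spectrum.pow_nnnorm_pow_one_div_tendsto_nhds_spectralRadius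
    a).eventually_lt_const hac, eventually_gt_atTop 0] with n hn hn0
  have hn0' : (0 : ℝ) < n := by exact_mod_cast hn0
  have hpow := ENNReal.rpow_le_rpow hn.le hn0'.le
  rw [← ENNReal.rpow_mul, one_div_mul_cancel hn0'.ne', ENNReal.rpow_one,
    ENNReal.rpow_natCast] at hpow
  exact_mod_cast hpow

theorem exists_common_eigenvector {𝕜 V : Type*} [Field 𝕜] [IsAlgClosed 𝕜] [AddCommGroup V]
    [Module 𝕜 V] [FiniteDimensional 𝕜 V] {f g : Module.End 𝕜 V} (hfg : Commute f g) {z : 𝕜}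
    (hz : f.HasEigenvalue z) : ∃ v ≠ 0, f v = z • v ∧ ∃ w : 𝕜, g v = w • v := by
  have hinv : Set.MapsTo g (f.eigenspace z) (f.eigenspace z) :=
    Module.End.mapsTo_genEigenspace_of_comm hfg z 1
  have : Nontrivial (f.eigenspace z) := Submodule.nontrivial_iff_ne_bot.2 hz
  obtain ⟨w, hw⟩ := Module.End.exists_eigenvalue (g.restrict hinv)
  obtain ⟨v, hv⟩ := hw.exists_hasEigenvector
  exact ⟨v, fun h => hv.2 (Subtype.ext h), Module.End.mem_eigenspace_iff.1 v.2, w,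
    congrArg Subtype.val hv.apply_eq_smul⟩

theorem analyticAt_matrix_det {𝕜 E 𝕜' n : Type*} [NontriviallyNormedField 𝕜] [NormedAddCommGroup E]
    [NormedSpace 𝕜 E] [NormedField 𝕜'] [NormedAlgebra 𝕜 𝕜'] [Fintype n] [DecidableEq n]
    {M : E → Matrix n n 𝕜'} {s : E} (hM : ∀ i j, AnalyticAt 𝕜 (fun t => M t i j) s) :
    AnalyticAt 𝕜 (fun t => (M t).det) s := by
  simp only [Matrix.det_apply']
  exact Finset.analyticAt_fun_sum _ fun σ _ =>
    analyticAt_const.mul (Finset.analyticAt_fun_prod _ fun i _ => hM _ _)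

theorem analyticAt_exp_smul {𝕜 A : Type*} [RCLike 𝕜] [NormedRing A] [NormedAlgebra 𝕜 A]
    [CompleteSpace A] (a : A) (s : 𝕜) : AnalyticAt 𝕜 (fun t : 𝕜 => NormedSpace.exp (t • a)) s :=
  (NormedSpace.exp_analytic (𝕂 := 𝕜) (s • a)).comp (f := fun t : 𝕜 => t • a)
    (analyticAt_id.smul analyticAt_const)

theorem analyticAt_det {𝕜 E 𝕜' V : Type*} [NontriviallyNormedField 𝕜] [NormedAddCommGroup E]
    [NormedSpace 𝕜 E] [NontriviallyNormedField 𝕜'] [CompleteSpace 𝕜'] [NormedAlgebra 𝕜 𝕜']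
    [NormedAddCommGroup V] [NormedSpace 𝕜 V] [NormedSpace 𝕜' V] [IsScalarTower 𝕜 𝕜' V]
    [FiniteDimensional 𝕜' V] {g : E → V →L[𝕜'] V} {s : E} (hg : AnalyticAt 𝕜 g s) :
    AnalyticAt 𝕜 (fun t => LinearMap.det (g t : V →ₗ[𝕜'] V)) s := by
  let b := Module.finBasis 𝕜' V
  simp only [← LinearMap.det_toMatrix b]
  refine analyticAt_matrix_det fun i j => ?_
  let entry : (V →L[𝕜'] V) →L[𝕜'] 𝕜' :=
    (b.coord i).toContinuousLinearMap ∘L ContinuousLinearMap.apply 𝕜' V (b j)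
  simpa only [LinearMap.toMatrix_apply] using! ((entry.restrictScalars 𝕜).analyticAt _).comp hg

theorem isUnit_iff_det_ne_zero {𝕜 V : Type*} [NontriviallyNormedField 𝕜] [CompleteSpace 𝕜]
    [NormedAddCommGroup V] [NormedSpace 𝕜 V] [FiniteDimensional 𝕜 V] {a : V →L[𝕜] V} :
    IsUnit a ↔ LinearMap.det (a : V →ₗ[𝕜] V) ≠ 0 := by
  have : CompleteSpace V := FiniteDimensional.complete 𝕜 V
  rw [ContinuousLinearMap.isUnit_iff_isUnit_toLinearMap, LinearMap.isUnit_iff_isUnit_det,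
    isUnit_iff_ne_zero]

namespace Quantum

variable {H : Type*} [NormedAddCommGroup H] [InnerProductSpace ℂ H]

@[simp] theorem tr_add (a b : H →L[ℂ] H) : tr (a + b) = tr a + tr b := by simp [tr]

@[simp] theorem tr_sub (a b : H →L[ℂ] H) : tr (a - b) = tr a - tr b := by simp [tr]

@[simp] theorem tr_smul (c : ℂ) (a : H →L[ℂ] H) : tr (c • a) = c * tr a := by simp [tr]

@[simp] theorem tr_zero : tr (0 : H →L[ℂ] H) = 0 := by simp [tr]

theorem tr_real_smul (c : ℝ) (a : H →L[ℂ] H) : tr (c • a) = c * tr a := by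
  rw [← Complex.coe_smul, tr_smul]

variable {a b ρ : H →L[ℂ] H}

theorem nonneg_iff_inner_nonneg : 0 ≤ a ↔ ∀ v, 0 ≤ ⟪v, a v⟫_ℂ := by
  rw [ContinuousLinearMap.nonneg_iff_isPositive]
  refine ⟨fun ha => ha.inner_nonneg_right, fun h => ?_⟩
  rw [ContinuousLinearMap.isPositive_iff_complex]
  intro v
  have hv : 0 ≤ ⟪a v, v⟫_ℂ := by
    rw [← inner_conj_symm]
    exact star_nonneg_iff.2 (h v)
  rw [Complex.nonneg_iff] at hv
  exact ⟨Complex.ext rfl (by simpa using hv.2), hv.1⟩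

theorem rankOne_self_nonneg (v : H) : (0 : H →L[ℂ] H) ≤ InnerProductSpace.rankOne ℂ v v :=
  (ContinuousLinearMap.nonneg_iff_isPositive _).2 (InnerProductSpace.isPositive_rankOne_self v)

theorem tr_nonneg (ha : 0 ≤ a) : 0 ≤ tr a :=
  ((ContinuousLinearMap.isPositive_toLinearMap_iff a).2
    ((ContinuousLinearMap.nonneg_iff_isPositive a).1 ha)).trace_nonneg

variable [FiniteDimensional ℂ H]

theorem continuous_tr : Continuous (tr : (H →L[ℂ] H) → ℂ) :=
  (LinearMap.trace ℂ H ∘ₗ ContinuousLinearMap.coeLM ℂ).continuous_of_finiteDimensional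

/-- The map `x ↦ tr (ρ x) 1` on operators: for a density `ρ`, the `ρ`-preserving conditional
expectation onto the scalars. It is the limit of a primitive semigroup that leaves `ρ` invariant. -/
noncomputable def expectation (ρ : H →L[ℂ] H) : Module.End ℂ (H →L[ℂ] H) :=
  (traceForm H ρ).smulRight 1

theorem expectation_apply (ρ x : H →L[ℂ] H) : expectation ρ x = tr (ρ * x) • 1 := rfl

theorem isIdempotentElem_expectation (h : tr ρ = 1) : IsIdempotentElem (expectation ρ) :=
  LinearMap.ext fun x => by
    change expectation ρ (expectation ρ x) = expectation ρ x
    rw [expectation_apply, expectation_apply, mul_smul_comm, mul_one, tr_smul, h, mul_one]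

theorem starProjection_support_mul (ρ : H →L[ℂ] H) : (support ρ).starProjection * ρ = ρ :=
  ContinuousLinearMap.ext fun v => Submodule.starProjection_eq_self_iff.2 <|
    Submodule.le_topologicalClosure _ ⟨v, rfl⟩

theorem mul_starProjection_support_eq_zero (h : b * ρ = 0) :
    b * (support ρ).starProjection = 0 := by
  have hker : support ρ ≤ LinearMap.ker (b : H →ₗ[ℂ] H) := by
    refine Submodule.topologicalClosure_minimal _ ?_ b.isClosed_ker
    rintro _ ⟨w, rfl⟩
    exact DFunLike.congr_fun h w
  exact ContinuousLinearMap.ext fun v => hker (Submodule.starProjection_apply_mem _ v)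

theorem isFaithful_of_starProjection_support_eq_one (h : (support ρ).starProjection = 1) :
    IsFaithful ρ :=
  eq_top_iff.2 fun v _ => Submodule.starProjection_eq_self_iff.1 (DFunLike.congr_fun h v)

variable [CompleteSpace H]

theorem tr_star_mul_self_mul_star_mul_self (c d : H →L[ℂ] H) :
    tr (star d * d * (star c * c)) = tr (star (d * star c) * (d * star c)) := by
  rw [← mul_assoc, tr_mul_comm, star_mul, star_star]
  simp only [mul_assoc]

theorem tr_mul_nonneg (ha : 0 ≤ a) (hb : 0 ≤ b) : 0 ≤ tr (a * b) := by
  obtain ⟨d, rfl⟩ := CStarAlgebra.nonneg_iff_eq_star_mul_self.1 ha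
  obtain ⟨c, rfl⟩ := CStarAlgebra.nonneg_iff_eq_star_mul_self.1 hb
  rw [tr_star_mul_self_mul_star_mul_self]
  exact tr_nonneg (star_mul_self_nonneg _)

theorem norm_le_tr (ha : 0 ≤ a) : ‖a‖ ≤ (tr a).re := by
  have htr := Complex.nonneg_iff.1 (tr_nonneg ha)
  have htr' : tr a = (tr a).re := Complex.ext rfl htr.2.symm
  rw [CStarAlgebra.norm_le_iff_le_algebraMap a htr.1 ha, ← sub_nonneg, nonneg_iff_inner_nonneg]
  intro v
  have hle : InnerProductSpace.rankOne ℂ v v ≤ algebraMap ℝ (H →L[ℂ] H) (‖v‖ ^ 2) := by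
    simpa [sq] using IsSelfAdjoint.le_algebraMap_norm_self (.of_nonneg (rankOne_self_nonneg v))
  have hpos := tr_mul_nonneg (sub_nonneg.2 hle) ha
  rw [sub_mul, tr_sub, tr_rankOne_mul, Algebra.algebraMap_eq_smul_one, smul_mul_assoc, one_mul,
    tr_real_smul, htr'] at hpos
  simpa [Algebra.algebraMap_eq_smul_one, inner_sub_right, inner_smul_right_eq_smul,
    inner_self_eq_norm_sq_to_K, mul_comm] using hpos

theorem eq_zero_of_tr_eq_zero (ha : 0 ≤ a) (h : tr a = 0) : a = 0 :=
  norm_le_zero_iff.1 (by simpa [h] using norm_le_tr ha)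

theorem mul_eq_zero_of_tr_mul_eq_zero (ha : 0 ≤ a) (hb : 0 ≤ b) (h : tr (a * b) = 0) :
    a * b = 0 := by
  obtain ⟨d, rfl⟩ := CStarAlgebra.nonneg_iff_eq_star_mul_self.1 ha
  obtain ⟨c, rfl⟩ := CStarAlgebra.nonneg_iff_eq_star_mul_self.1 hb
  rw [tr_star_mul_self_mul_star_mul_self] at h
  have hdc : d * star c = 0 := (CStarRing.star_mul_self_eq_zero_iff _).1
    (eq_zero_of_tr_eq_zero (star_mul_self_nonneg _) h)
  rw [mul_assoc, ← mul_assoc d, hdc, zero_mul, mul_zero]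

theorem tendsto_traceNorm_zero_iff {ι : Type*} {l : Filter ι} {f : ι → H →L[ℂ] H} :
    Tendsto (fun i => traceNorm (f i)) l (𝓝 0) ↔ Tendsto f l (𝓝 0) := by
  constructor <;> intro h
  · refine squeeze_zero_norm (fun i => ?_) h
    rw [← CFC.norm_abs (a := f i)]
    exact norm_le_tr (CFC.abs_nonneg _)
  · have habs : Tendsto (fun i => CFC.abs (f i)) l (𝓝 0) := by
      rw [tendsto_zero_iff_norm_tendsto_zero] at h ⊢
      simpa using h
    have hre := (Complex.continuous_re.comp (continuous_tr (H := H))).tendsto 0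
    simpa [traceNorm, Function.comp_def] using hre.comp habs

theorem tendsto_of_tendsto_tr {ι : Type*} {l : Filter ι} {f : ι → H →L[ℂ] H}
    (h : ∀ x, Tendsto (fun i => tr (f i * x)) l (𝓝 (tr (a * x)))) : Tendsto f l (𝓝 a) := by
  let pairing : (H →L[ℂ] H) →ₗ[ℂ] ((H →L[ℂ] H) → ℂ) := LinearMap.pi fun x => (traceForm H).flip x
  have hker : LinearMap.ker pairing = ⊥ := LinearMap.ker_eq_bot'.2 fun c hc =>
    traceForm_nondegenerate.1 c (congrFun hc)
  rw [(LinearMap.isClosedEmbedding_of_injective hker).isEmbedding.tendsto_nhds_iff,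
    tendsto_pi_nhds]
  exact h

theorem isUnit_of_isFaithful (h : IsFaithful ρ) : IsUnit ρ := by
  rw [ContinuousLinearMap.isUnit_iff_isUnit_toLinearMap, LinearMap.isUnit_iff_range_eq_top]
  exact (Submodule.closed_of_finiteDimensional _).submodule_topologicalClosure_eq.symm.trans h

theorem eq_zero_of_isFaithful (hρ : 0 ≤ ρ) (hf : IsFaithful ρ) (hb : 0 ≤ b)
    (h : tr (ρ * b) = 0) : b = 0 :=
  (isUnit_of_isFaithful hf).mul_right_eq_zero.1 (mul_eq_zero_of_tr_mul_eq_zero hρ hb h)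

section Predual

variable {Φ : (H →L[ℂ] H) →ₗ[ℂ] (H →L[ℂ] H)} {η ζ : H →L[ℂ] H}

theorem predual_unique (h : ∀ x, tr (ζ * x) = tr (η * Φ x)) : predual Φ η = ζ := by
  rw [← sub_eq_zero]
  refine eq_zero_of_tr _ fun x => ?_
  rw [tr_mul_comm, sub_mul, tr_sub, tr_predual_mul, h, sub_self]

theorem predual_nonneg (hΦ : ∀ x, 0 ≤ x → 0 ≤ Φ x) (hη : 0 ≤ η) : 0 ≤ predual Φ η := by
  refine nonneg_iff_inner_nonneg.2 fun v => ?_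
  rw [← tr_rankOne_mul, tr_mul_comm, tr_predual_mul]
  exact tr_mul_nonneg hη (hΦ _ (rankOne_self_nonneg v))

theorem isDensity_predual (hΦ : ∀ x, 0 ≤ x → 0 ≤ Φ x) (hΦ1 : Φ 1 = 1) (hη : IsDensity η) :
    IsDensity (predual Φ η) := by
  refine ⟨predual_nonneg hΦ hη.1, ?_⟩
  rw [← mul_one (predual Φ η), tr_predual_mul, hΦ1, mul_one, hη.2]

end Predual

section Density

theorem isCompact_setOf_isDensity : IsCompact {η : H →L[ℂ] H | IsDensity η} := by
  have : ProperSpace (H →L[ℂ] H) := FiniteDimensional.proper ℂ _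
  refine Metric.isCompact_of_isClosed_isBounded
    (isClosed_Ici.inter (isClosed_eq continuous_tr continuous_const)) ?_
  refine (Metric.isBounded_closedBall (x := 0) (r := 1)).subset fun η hη => ?_
  simpa [hη.2] using norm_le_tr hη.1

omit [FiniteDimensional ℂ H] in
theorem convex_setOf_isDensity : Convex ℝ {η : H →L[ℂ] H | IsDensity η} := by
  intro a ha b hb s t hs ht hst
  refine ⟨add_nonneg (smul_nonneg hs ha.1) (smul_nonneg ht hb.1), ?_⟩
  rw [tr_add, tr_real_smul, tr_real_smul, ha.2, hb.2, mul_one, mul_one]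
  exact_mod_cast hst

theorem isDensity_rankOne_self {v : H} (hv : ‖v‖ = 1) :
    IsDensity (InnerProductSpace.rankOne ℂ v v) := by
  refine ⟨rankOne_self_nonneg v, ?_⟩
  rw [← mul_one (InnerProductSpace.rankOne ℂ v v), tr_rankOne_mul, one_apply_eq_self,
    inner_self_eq_norm_sq_to_K, hv]
  simp

theorem exists_isDensity [Nontrivial H] : ∃ η : H →L[ℂ] H, IsDensity η :=
  let ⟨_, hv⟩ := exists_norm_eq H zero_le_one
  ⟨_, isDensity_rankOne_self hv⟩

theorem eq_smul_one_of_forall_isDensity {x : H →L[ℂ] H} {c : ℂ}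
    (h : ∀ η, IsDensity η → tr (η * x) = c) : x = c • (1 : H →L[ℂ] H) := by
  have hnonneg {η : H →L[ℂ] H} (hη : 0 ≤ η) : tr (η * x) = c * tr η := by
    by_cases h0 : tr η = 0
    · simp [eq_zero_of_tr_eq_zero hη h0]
    have hdensity : IsDensity ((tr η)⁻¹ • η) :=
      ⟨smul_nonneg (inv_nonneg.2 (tr_nonneg hη)) hη, by rw [tr_smul, inv_mul_cancel₀ h0]⟩
    have := h _ hdensity
    rwa [smul_mul_assoc, tr_smul, inv_mul_eq_iff_eq_mul₀ h0, mul_comm] at this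
  have hform : (traceForm H).flip (x - c • 1) = 0 :=
    LinearMap.ext_on CStarAlgebra.span_nonneg fun η hη => by
      change tr (η * (x - c • 1)) = 0
      rw [mul_sub, mul_smul_comm, mul_one, tr_sub, tr_smul, hnonneg hη, sub_self]
  exact sub_eq_zero.1 (eq_zero_of_tr _ (LinearMap.congr_fun hform))

end Density

end Quantum

namespace QMS

variable {H : Type*} [NormedAddCommGroup H] [InnerProductSpace ℂ H] [CompleteSpace H]
  [FiniteDimensional ℂ H] {T : QMS H} {ρ σ x : H →L[ℂ] H}

section InvariantDensity

theorem tr_predual (t : ℝ≥0) (η x : H →L[ℂ] H) : tr (T.predual t η * x) = tr (η * T.map t x) :=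
  tr_predual_mul _ η x

theorem predual_add (s t : ℝ≥0) (η : H →L[ℂ] H) :
    T.predual (s + t) η = T.predual t (T.predual s η) :=
  predual_unique fun x => (tr_predual t _ x).trans <| (tr_predual s η _).trans <|
    congrArg (fun y => tr (η * y)) (T.map_add s t x).symm

theorem isDensity_predual {η : H →L[ℂ] H} (hη : IsDensity η) (t : ℝ≥0) :
    IsDensity (T.predual t η) :=
  Quantum.isDensity_predual (fun _ => map_nonneg (T.map t)) (T.map_one t) hη

theorem exists_invariant_mem {K : Set (H →L[ℂ] H)} (hKd : K ⊆ {η | IsDensity η})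
    (hKc : IsClosed K) (hconv : Convex ℝ K) (hne : K.Nonempty)
    (hK : ∀ t, Set.MapsTo (T.predual t) K K) : ∃ ρ ∈ K, T.IsInvariantDensity ρ := by
  let f (t : ℝ≥0) := (LinearMap.toContinuousLinearMap (T.predual t)).restrictScalars ℝ
  have hcomm (s t : ℝ≥0) : Commute (f s) (f t) := ContinuousLinearMap.ext fun η => by
    change T.predual s (T.predual t η) = T.predual t (T.predual s η)
    rw [← predual_add, ← predual_add, add_comm]
  obtain ⟨ρ, hρ, hfix⟩ := exists_common_fixedPoint_of_mapsTo
    (isCompact_setOf_isDensity.of_isClosed_subset hKc hKd) hconv hne f hcomm hK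
  exact ⟨ρ, hρ, hKd hρ, hfix⟩

theorem exists_isInvariantDensity [Nontrivial H] : ∃ ρ, T.IsInvariantDensity ρ :=
  let ⟨ρ, _, hρ⟩ := exists_invariant_mem subset_rfl isCompact_setOf_isDensity.isClosed
    convex_setOf_isDensity exists_isDensity fun t _ hη => isDensity_predual hη t
  ⟨ρ, hρ⟩

theorem exists_isInvariantDensity_tr_mul_eq (hx : ∀ t, T.map t x = x) {η : H →L[ℂ] H}
    (hη : IsDensity η) : ∃ ρ, T.IsInvariantDensity ρ ∧ tr (ρ * x) = tr (η * x) := by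
  let K : Set (H →L[ℂ] H) := {ζ | IsDensity ζ} ∩ {ζ | tr (ζ * x) = tr (η * x)}
  have hclosed : IsClosed K := isCompact_setOf_isDensity.isClosed.inter
    (isClosed_eq (continuous_tr.comp (continuous_mul_const x)) continuous_const)
  have hconv : Convex ℝ K := convex_setOf_isDensity.inter <|
    (convex_singleton _).linear_preimage (((traceForm H).flip x).restrictScalars ℝ)
  obtain ⟨ρ, hρK, hρ⟩ := exists_invariant_mem (T := T) (fun _ hζ => hζ.1) hclosed hconv
    ⟨η, hη, rfl⟩ fun t ζ hζ => ⟨isDensity_predual hζ.1 t, by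
      rw [Set.mem_ofPred_eq, tr_predual, hx]
      exact hζ.2⟩
  exact ⟨ρ, hρ, hρK.2⟩

theorem eq_tr_smul_one_of_fixed (huniq : ∀ σ, T.IsInvariantDensity σ → σ = ρ)
    (hx : ∀ t, T.map t x = x) : x = tr (ρ * x) • (1 : H →L[ℂ] H) :=
  eq_smul_one_of_forall_isDensity fun η hη => by
    obtain ⟨σ, hσ, hση⟩ := exists_isInvariantDensity_tr_mul_eq hx hη
    rw [← hση, huniq σ hσ]

theorem IsInvariantDensity.add_smul_sub (hρ : T.IsInvariantDensity ρ)
    (hσ : T.IsInvariantDensity σ) {s : ℝ} (hs : 0 ≤ ρ + s • (ρ - σ)) :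
    T.IsInvariantDensity (ρ + s • (ρ - σ)) := by
  refine ⟨⟨hs, ?_⟩, fun t => ?_⟩
  · rw [tr_add, tr_real_smul, tr_sub, hρ.1.2, hσ.1.2, sub_self, mul_zero, add_zero]
  · rw [_root_.map_add, LinearMap.map_smul_of_tower, map_sub, hρ.2, hσ.2]

theorem isPrimitive_of_forall_isFaithful [Nontrivial H]
    (h : ∀ ρ, T.IsInvariantDensity ρ → IsFaithful ρ) : T.IsPrimitive := by
  obtain ⟨ρ, hρ⟩ := exists_isInvariantDensity (T := T)
  refine ⟨ρ, hρ, h ρ hρ, fun σ hσ => (sub_eq_zero.1 ?_).symm⟩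
  exact eq_zero_of_forall_isUnit_add_smul hρ.1.1 (.sub (.of_nonneg hρ.1.1) (.of_nonneg hσ.1.1))
    fun s hs => isUnit_of_isFaithful (h _ (hρ.add_smul_sub hσ hs))

theorem IsInvariantDensity.tr_mul_map (hρ : T.IsInvariantDensity ρ) (t : ℝ≥0)
    (x : H →L[ℂ] H) : tr (ρ * T.map t x) = tr (ρ * x) := by
  rw [← tr_predual, hρ.2]

theorem IsInvariantDensity.le_map_starProjection_support (hρ : T.IsInvariantDensity ρ)
    (t : ℝ≥0) : (support ρ).starProjection ≤ T.map t (support ρ).starProjection := by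
  set p := (support ρ).starProjection
  have hp : IsStarProjection p := isStarProjection_starProjection
  have hle : T.map t (1 - p) ≤ 1 :=
    (OrderHomClass.mono (T.map t) (sub_le_self 1 hp.nonneg)).trans_eq (T.map_one t)
  have hpos : 0 ≤ T.map t (1 - p) := map_nonneg _ hp.one_sub.nonneg
  have htr : tr (T.map t (1 - p) * ρ) = 0 := by
    rw [tr_mul_comm, hρ.tr_mul_map, tr_mul_comm, sub_mul, starProjection_support_mul, one_mul,
      sub_self, tr_zero]
  have hmul := mul_starProjection_support_eq_zero (mul_eq_zero_of_tr_mul_eq_zero hpos hρ.1.1 htr)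
  have hsub := le_one_sub_of_mul_eq_zero hle (.of_nonneg hpos) hp hmul
  rwa [map_sub, T.map_one, sub_le_sub_iff_left] at hsub

theorem IsIrreducible.isFaithful (hT : T.IsIrreducible) (hρ : T.IsInvariantDensity ρ) :
    IsFaithful ρ := by
  refine isFaithful_of_starProjection_support_eq_one <|
    (hT _ isStarProjection_starProjection hρ.le_map_starProjection_support).resolve_left
      fun h => ?_
  have htr := hρ.1.2
  rw [← starProjection_support_mul ρ, h, zero_mul, tr_zero] at htr
  exact zero_ne_one htr

theorem map_eq_of_le_map (hρ : T.IsInvariantDensity ρ) (hf : IsFaithful ρ) {t : ℝ≥0}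
    (h : x ≤ T.map t x) : T.map t x = x := by
  refine sub_eq_zero.1 (eq_zero_of_isFaithful hρ.1.1 hf (sub_nonneg.2 h) ?_)
  rw [mul_sub, tr_sub, hρ.tr_mul_map, sub_self]

end InvariantDensity

section Generator

theorem hasDerivWithinAt_map (x : H →L[ℂ] H) {t : ℝ} (ht : 0 ≤ t) :
    HasDerivWithinAt (fun s : ℝ => T.map s.toNNReal x) (T.generator (T.map t.toNNReal x))
      (Set.Ici t) t := by
  have hzero : HasDerivWithinAt (fun s : ℝ => T.map s.toNNReal (T.map t.toNNReal x))
      (T.generator (T.map t.toNNReal x)) (Set.Ici 0) (t - t) := by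
    rw [sub_self]
    exact T.hasDerivWithinAt_generator _
  have hshift := hzero.scomp (h := fun s : ℝ => s - t) t
    ((hasDerivAt_id t).sub_const t).hasDerivWithinAt
    (fun s (hs : t ≤ s) => sub_nonneg.2 hs : Set.MapsTo _ (Set.Ici t) _)
  rw [one_smul] at hshift
  have hadd (s : ℝ) (hs : t ≤ s) :
      T.map s.toNNReal x = T.map (s - t).toNNReal (T.map t.toNNReal x) := by
    rw [← T.map_add, ← Real.toNNReal_add (sub_nonneg.2 hs) ht, sub_add_cancel]
  exact hshift.congr hadd (hadd t le_rfl)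

theorem map_eq_of_hasDerivAt {v : ℝ → H →L[ℂ] H}
    (hv : ∀ t, HasDerivAt v (T.generator (v t)) t) (t : ℝ≥0) : T.map t (v 0) = v t := by
  let L := LinearMap.toContinuousLinearMap T.generator
  have h := ODE_solution_unique (v := fun _ => L) (K := ‖L‖₊) (a := 0) (b := t)
    (f := fun s : ℝ => T.map s.toNNReal (v 0)) (g := v) (fun _ => L.lipschitz)
    ((T.continuous_map_apply _).comp continuous_real_toNNReal).continuousOn
    (fun s hs => T.hasDerivWithinAt_map _ hs.1)
    (fun s _ => (hv s).continuousAt.continuousWithinAt)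
    (fun s _ => (hv s).hasDerivWithinAt) (by simp [T.map_zero]) ⟨t.2, le_rfl⟩
  simpa using h

theorem map_eq_exp (t : ℝ≥0) (x : H →L[ℂ] H) : T.map t x =
    NormedSpace.exp ((t : ℝ) • LinearMap.toContinuousLinearMap T.generator) x := by
  set L := LinearMap.toContinuousLinearMap T.generator
  have h := T.map_eq_of_hasDerivAt (v := fun s : ℝ => NormedSpace.exp (s • L) x) (fun s =>
    ((ContinuousLinearMap.apply ℂ (H →L[ℂ] H) x).restrictScalars
      ℝ).hasFDerivAt.comp_hasDerivAt s (hasDerivAt_exp_smul_const' L s)) t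
  have hL : (0 : ℝ) • L = 0 := zero_smul ℝ L
  simpa only [hL, NormedSpace.exp_zero, one_apply_eq_self] using h

theorem generator_eq_of_hasDerivWithinAt {y : H →L[ℂ] H}
    (h : HasDerivWithinAt (fun t : ℝ => T.map t.toNNReal x) y (Set.Ici 0) 0) :
    T.generator x = y :=
  (uniqueDiffOn_Ici 0 0 Set.self_mem_Ici).eq_deriv _ (T.hasDerivWithinAt_generator x) h

theorem generator_eq_smul_iff {μ : ℂ} :
    T.generator x = μ • x ↔ ∀ t : ℝ≥0, T.map t x = Complex.exp (μ * (t : ℝ)) • x := by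
  have hexp (s : ℝ) :
      HasDerivAt (fun s : ℝ => Complex.exp (μ * s) • x) ((Complex.exp (μ * s) * μ) • x) s := by
    have := ((hasDerivAt_id (s : ℂ)).const_mul μ).cexp.comp_ofReal
    exact HasDerivAt.smul_const (by simpa using this) x
  constructor <;> intro h
  · intro t
    have := map_eq_of_hasDerivAt (T := T) (fun s => by
      rw [map_smul, h, smul_smul]
      exact hexp s) t
    simpa using this
  · refine generator_eq_of_hasDerivWithinAt ?_
    have hderiv := (hexp 0).hasDerivWithinAt (s := Set.Ici 0)
    rw [Complex.ofReal_zero, mul_zero, Complex.exp_zero, one_mul] at hderiv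
    refine hderiv.congr (fun t ht => ?_) (by simp [T.map_zero])
    rw [h, Real.coe_toNNReal t ht]

theorem generator_map (t : ℝ≥0) (x : H →L[ℂ] H) :
    T.generator (T.map t x) = T.map t (T.generator x) := by
  have hcomm (s : ℝ) : T.map s.toNNReal (T.map t x) = T.map t (T.map s.toNNReal x) := by
    rw [← T.map_add, add_comm, T.map_add]
  refine generator_eq_of_hasDerivWithinAt ?_
  simp only [hcomm]
  exact ((LinearMap.toContinuousLinearMap (T.map t).toLinearMap).restrictScalars
    ℝ).hasFDerivAt.comp_hasDerivWithinAt 0 (T.hasDerivWithinAt_generator x)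

theorem generator_one : T.generator 1 = 0 := by
  simpa using (generator_eq_smul_iff (T := T) (x := 1) (μ := 0)).2 (by simp [T.map_one])

theorem IsInvariantDensity.tr_mul_generator (hρ : T.IsInvariantDensity ρ) (x : H →L[ℂ] H) :
    tr (ρ * T.generator x) = 0 := by
  have h := ((LinearMap.toContinuousLinearMap (traceForm H ρ)).restrictScalars
    ℝ).hasFDerivAt.comp_hasDerivWithinAt 0 (T.hasDerivWithinAt_generator x)
  refine (uniqueDiffOn_Ici (0 : ℝ) 0 Set.self_mem_Ici).eq_deriv _ h ?_
  exact (hasDerivWithinAt_const 0 (Set.Ici 0) (tr (ρ * x))).congr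
    (fun s _ => hρ.tr_mul_map _ x) (hρ.tr_mul_map _ x)

end Generator

section Peripheral

theorem map_star_mul_self_eq (hρ : T.IsInvariantDensity ρ) (hf : IsFaithful ρ) {t : ℝ≥0} {z : ℂ}
    (hz : ‖z‖ = 1) (hx : T.map t x = z • x) : T.map t (star x * x) = star x * x := by
  have hSchwarz := star_map_mul_map_self_le (T.map_one t) x
  rw [hx, star_smul_mul_smul_self hz] at hSchwarz
  exact map_eq_of_le_map hρ hf hSchwarz

theorem map_pow_eq_smul (hρ : T.IsInvariantDensity ρ) (hf : IsFaithful ρ) {t : ℝ≥0} {z : ℂ}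
    (hz : ‖z‖ = 1) (hx : T.map t x = z • x) (n : ℕ) : T.map t (x ^ n) = z ^ n • x ^ n := by
  have hmul : T.map t (star x * x) = star (T.map t x) * T.map t x := by
    rw [map_star_mul_self_eq hρ hf hz hx, hx, star_smul_mul_smul_self hz]
  induction n with
  | zero => simp [T.map_one]
  | succ n ih =>
    rw [pow_succ, map_mul_of_map_star_mul_self (T.map_one t) hmul, ih, hx, smul_mul_smul_comm,
      pow_succ]

end Peripheral

section Primitive

variable (hρ : T.IsInvariantDensity ρ) (hf : IsFaithful ρ)
  (huniq : ∀ σ, T.IsInvariantDensity σ → σ = ρ)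

include hρ hf huniq

theorem isLeftRegular_of_generator_eq_smul (hx0 : x ≠ 0) {μ : ℂ} (hμ : μ.re = 0)
    (hx : T.generator x = μ • x) : IsLeftRegular x := by
  have hfix := eq_tr_smul_one_of_fixed huniq fun t => map_star_mul_self_eq hρ hf
    (z := Complex.exp (μ * (t : ℝ))) (by simp [Complex.norm_exp, hμ])
    (generator_eq_smul_iff.1 hx t)
  set c := tr (ρ * (star x * x))
  have hc : c ≠ 0 := fun h => hx0 <| (CStarRing.star_mul_self_eq_zero_iff x).1 <| by
    rw [hfix, h, zero_smul]
  have hunit : IsUnit (star x * x) := hfix ▸ isUnit_one.smul (Units.mk0 c hc)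
  exact hunit.isRegular.left.of_mul

theorem eq_zero_of_generator_eq_smul (hx0 : x ≠ 0) {μ : ℂ} (hμ : μ.re = 0)
    (hx : T.generator x = μ • x) : μ = 0 := by
  have : Nontrivial (H →L[ℂ] H) := nontrivial_of_ne x 0 hx0
  have hreg := isLeftRegular_of_generator_eq_smul hρ hf huniq hx0 hμ hx
  have hev (n : ℕ) : Module.End.HasEigenvalue T.generator (n * μ) := by
    refine Module.End.hasEigenvalue_of_hasEigenvector (x := x ^ n) <|
      Module.End.hasEigenvector_iff.2
        ⟨Module.End.mem_eigenspace_iff.2 (generator_eq_smul_iff.2 fun t => ?_),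
          (hreg.pow n).ne_zero⟩
    rw [map_pow_eq_smul hρ hf (by simp [Complex.norm_exp, hμ]) (generator_eq_smul_iff.1 hx t) n,
      ← Complex.exp_nat_mul, mul_assoc]
  by_contra hne
  refine (Set.infinite_range_of_injective (f := fun n : ℕ => (n : ℂ) * μ) fun m n h => ?_)
    ((Module.End.finite_hasEigenvalue T.generator).subset (Set.range_subset_iff.2 hev))
  exact_mod_cast mul_right_cancel₀ hne h

end Primitive

section Expectation

theorem map_mul_expectation (t : ℝ≥0) (ρ : H →L[ℂ] H) :
    (T.map t).toLinearMap * expectation ρ = expectation ρ :=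
  LinearMap.ext fun x => by
    change T.map t (tr (ρ * x) • 1) = tr (ρ * x) • 1
    rw [map_smul, T.map_one]

theorem IsInvariantDensity.expectation_mul_map (hρ : T.IsInvariantDensity ρ) (t : ℝ≥0) :
    expectation ρ * (T.map t).toLinearMap = expectation ρ :=
  LinearMap.ext fun x => congrArg (· • (1 : H →L[ℂ] H)) (hρ.tr_mul_map t x)

theorem IsInvariantDensity.commute_map_sub_expectation_generator (hρ : T.IsInvariantDensity ρ)
    (t : ℝ≥0) : Commute ((T.map t).toLinearMap - expectation ρ) T.generator := by
  refine LinearMap.ext fun x => ?_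
  change T.map t (T.generator x) - tr (ρ * T.generator x) • (1 : H →L[ℂ] H)
    = T.generator (T.map t x - tr (ρ * x) • 1)
  rw [hρ.tr_mul_generator, map_sub, map_smul, generator_one, generator_map, zero_smul, smul_zero]

theorem toLinearMap_map_one_pow (n : ℕ) : (T.map 1).toLinearMap ^ n = (T.map n).toLinearMap := by
  induction n with
  | zero => exact LinearMap.ext fun x => by simpa using! (T.map_zero x).symm
  | succ n ih =>
    rw [pow_succ, ih, Nat.cast_succ]
    exact LinearMap.ext fun x => (T.map_add n 1 x).symm

end Expectation

section Convergence

variable (hρ : T.IsInvariantDensity ρ) (hf : IsFaithful ρ)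
  (huniq : ∀ σ, T.IsInvariantDensity σ → σ = ρ)

include hρ hf huniq

theorem norm_lt_one_of_hasEigenvalue {z : ℂ}
    (hz : Module.End.HasEigenvalue ((T.map 1).toLinearMap - expectation ρ) z) : ‖z‖ < 1 := by
  by_contra! hz1
  obtain ⟨y, hy0, hyz, μ, hyμ⟩ := exists_common_eigenvector
    (hρ.commute_map_sub_expectation_generator 1) hz
  have hyz' : T.map 1 y - tr (ρ * y) • (1 : H →L[ℂ] H) = z • y := hyz
  have hz0 : z ≠ 0 := norm_pos_iff.1 (one_pos.trans_le hz1)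
  have htr : tr (ρ * y) = 0 := by
    have h := congrArg (fun a => tr (ρ * a)) hyz'
    simp only [mul_sub, tr_sub, mul_smul_comm, tr_smul, mul_one, hρ.1.2, hρ.tr_mul_map,
      sub_self] at h
    exact (mul_eq_zero.1 h.symm).resolve_left hz0
  rw [htr, zero_smul, sub_zero] at hyz'
  have hmap := generator_eq_smul_iff.1 hyμ
  have hexp : Complex.exp μ = z :=
    smul_left_injective ℂ hy0 (by simpa using (hmap 1).symm.trans hyz')
  have hle : ‖z‖ ≤ 1 := by
    have := norm_map_le_of_map_one (T.map_one 1) y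
    rw [hyz', norm_smul] at this
    exact le_of_mul_le_mul_right (this.trans_eq (one_mul _).symm) (norm_pos_iff.2 hy0)
  have hre : μ.re = 0 := by
    simpa [← hexp, Complex.norm_exp] using hle.antisymm hz1
  have hμ := eq_zero_of_generator_eq_smul hρ hf huniq hy0 hre hyμ
  have hfix := eq_tr_smul_one_of_fixed huniq (x := y) fun t => by simp [hmap, hμ]
  rw [htr, zero_smul] at hfix
  exact hy0 hfix

theorem tendsto_map_natCast_expectation (x : H →L[ℂ] H) :
    Tendsto (fun n : ℕ => T.map n x) atTop (𝓝 (expectation ρ x)) := by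
  let R := LinearMap.toContinuousLinearMap ((T.map 1).toLinearMap - expectation ρ)
  have hspec (z : ℂ) (hz : z ∈ spectrum ℂ R) : ‖z‖ < 1 := by
    rw [ContinuousLinearMap.spectrum_eq, ← Module.End.hasEigenvalue_iff_mem_spectrum] at hz
    exact norm_lt_one_of_hasEigenvalue hρ hf huniq hz
  have hR (n : ℕ) : (R ^ (n + 1)) x = T.map (n + 1 : ℕ) x - expectation ρ x := by
    have h := sub_pow_succ_of_mul_eq (isIdempotentElem_expectation hρ.1.2)
      (map_mul_expectation 1 ρ) (hρ.expectation_mul_map 1) n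
    rw [toLinearMap_map_one_pow] at h
    rw [← ContinuousLinearMap.coe_coe, ContinuousLinearMap.toLinearMap_pow]
    exact LinearMap.congr_fun h x
  have hlim := ((ContinuousLinearMap.apply ℂ (H →L[ℂ] H) x).continuous.tendsto 0).comp <|
    (tendsto_add_atTop_iff_nat 1).2 (tendsto_pow_zero_of_spectrum_lt hspec)
  refine (tendsto_add_atTop_iff_nat 1).1 (tendsto_sub_nhds_zero_iff.1 ?_)
  simpa [Function.comp_def, hR] using hlim

theorem tendsto_map_expectation (x : H →L[ℂ] H) :
    Tendsto (fun t => T.map t x) atTop (𝓝 (expectation ρ x)) := by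
  have hanti : Antitone fun t => ‖T.map t x - expectation ρ x‖ := fun s t hst => by
    obtain ⟨r, rfl⟩ := exists_add_of_le hst
    have hfix : T.map r (expectation ρ x) = expectation ρ x :=
      LinearMap.congr_fun (map_mul_expectation r ρ) x
    have h := norm_map_le_of_map_one (T.map_one r) (T.map s x - expectation ρ x)
    rwa [map_sub, hfix, ← T.map_add, add_comm] at h
  rw [tendsto_iff_norm_sub_tendsto_zero,
    tendsto_iff_tendsto_subseq_of_antitone hanti tendsto_natCast_atTop_atTop]
  exact tendsto_iff_norm_sub_tendsto_zero.1 (tendsto_map_natCast_expectation hρ hf huniq x)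

theorem IsInvariantDensity.relaxesTo_of_unique {η : H →L[ℂ] H} (hη : IsDensity η) :
    T.RelaxesTo η ρ := by
  rw [RelaxesTo, tendsto_traceNorm_zero_iff, tendsto_sub_nhds_zero_iff]
  refine tendsto_of_tendsto_tr fun x => ?_
  have h := ((continuous_tr.comp (continuous_const_mul η)).tendsto _).comp
    (tendsto_map_expectation hρ hf huniq x)
  simpa [Function.comp_def, expectation_apply, tr_predual, hη.2] using h

end Convergence

section PositivityImproving

theorem analyticOnNhd_det_exp_smul_generator (T : QMS H) (x : H →L[ℂ] H) :
    AnalyticOnNhd ℝ (fun s : ℝ => LinearMap.det (NormedSpace.exp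
      (s • LinearMap.toContinuousLinearMap T.generator) x : H →ₗ[ℂ] H)) Set.univ := fun s _ =>
  analyticAt_det <| (((ContinuousLinearMap.apply ℂ (H →L[ℂ] H) x).restrictScalars
    ℝ).analyticAt _).comp (analyticAt_exp_smul _ s)

/-- The operator `𝓣_s x` is singular for every `s ≤ t`, because `𝓣` preserves strict positivity,
and then for all `s`, because `s ↦ det (𝓣_s x)` is analytic. -/
theorem not_isUnit_map (hx : 0 ≤ x) {t : ℝ≥0} (ht : 0 < t) (hsing : ¬ IsUnit (T.map t x))
    (s : ℝ≥0) : ¬ IsUnit (T.map s x) := by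
  have hearlier (r : ℝ≥0) (hr : r ≤ t) : ¬ IsUnit (T.map r x) := fun hu => hsing <| by
    obtain ⟨q, rfl⟩ := exists_add_of_le hr
    rw [add_comm, T.map_add]
    exact (isStrictlyPositive_map (T.map_one q) ⟨map_nonneg _ hx, hu⟩).isUnit
  simp only [isUnit_iff_det_ne_zero, not_not, map_eq_exp] at hearlier ⊢
  have ht' : (0 : ℝ) < t := ht
  refine (T.analyticOnNhd_det_exp_smul_generator x).eqOn_of_preconnected_of_eventuallyEq
    (fun _ _ => analyticAt_const) isPreconnected_univ (Set.mem_univ ((t : ℝ) / 2)) ?_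
    (Set.mem_univ _)
  filter_upwards [Ioo_mem_nhds (half_pos ht') (half_lt_self ht')] with r hr
  lift r to ℝ≥0 using hr.1.le
  exact hearlier r (by exact_mod_cast hr.2.le)

theorem IsPrimitive.isPositivityImproving (hT : T.IsPrimitive) : T.IsPositivityImproving := by
  obtain ⟨ρ, hρ, hf, huniq⟩ := hT
  refine fun x hx hx0 t ht => ⟨map_nonneg _ hx, ?_⟩
  by_contra hsing
  have htr : tr (ρ * x) ≠ 0 := fun h => hx0 (eq_zero_of_isFaithful hρ.1.1 hf hx h)
  have hlim : IsUnit (expectation ρ x) := isUnit_one.smul (Units.mk0 _ htr)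
  obtain ⟨s, hs⟩ :=
    ((tendsto_map_expectation hρ hf huniq x).eventually (Units.isOpen.mem_nhds hlim)).exists
  exact not_isUnit_map hx ht hsing s hs

theorem IsPositivityImproving.isIrreducibleMap (hT : T.IsPositivityImproving) {t : ℝ≥0}
    (ht : 0 < t) : IsIrreducibleMap (T.map t) := by
  refine fun p hp hsub => or_iff_not_imp_right.2 fun hp1 => ?_
  have hpos := hT (1 - p) hp.one_sub.nonneg (sub_ne_zero.2 (Ne.symm hp1)) t ht
  have hle : T.map t (1 - p) ≤ 1 - p := by
    rw [map_sub, T.map_one]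
    exact sub_le_sub_left hsub 1
  exact (hpos.of_le hle).isUnit.mul_left_eq_zero.1 hp.isIdempotentElem.mul_one_sub_self

end PositivityImproving

theorem IsPrimitive.spectrum_inter [Nontrivial H] (hT : T.IsPrimitive) :
    spectrum ℂ T.generator ∩ {z : ℂ | z.re = 0} = {0} := by
  obtain ⟨ρ, hρ, hf, huniq⟩ := hT
  ext z
  rw [Set.mem_inter_iff, ← Module.End.hasEigenvalue_iff_mem_spectrum, Set.mem_singleton_iff]
  constructor
  · rintro ⟨hz, hre⟩
    obtain ⟨x, hx⟩ := hz.exists_hasEigenvector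
    exact eq_zero_of_generator_eq_smul hρ hf huniq hx.2 hre hx.apply_eq_smul
  · rintro rfl
    refine ⟨Module.End.hasEigenvalue_of_hasEigenvector (x := 1)
      (Module.End.hasEigenvector_iff.2 ⟨Module.End.mem_eigenspace_iff.2 ?_, one_ne_zero⟩), rfl⟩
    rw [generator_one, zero_smul]

theorem RelaxesTo.unique {η σ : H →L[ℂ] H} (hρ : T.RelaxesTo η ρ) (hσ : T.RelaxesTo η σ) :
    ρ = σ := by
  rw [RelaxesTo, tendsto_traceNorm_zero_iff, tendsto_sub_nhds_zero_iff] at hρ hσ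
  exact tendsto_nhds_unique hρ hσ

theorem IsInvariantDensity.relaxesTo_self (hρ : T.IsInvariantDensity ρ) : T.RelaxesTo ρ ρ := by
  rw [RelaxesTo, tendsto_traceNorm_zero_iff]
  simp [hρ.2]

end QMS

theorem theorem4p2 {H : Type*} [NormedAddCommGroup H] [InnerProductSpace ℂ H] [CompleteSpace H]
    [FiniteDimensional ℂ H] [Nontrivial H] (T : QMS H) :
    List.TFAE [
      T.IsIrreducible,
      T.IsPrimitive,
      ∀ t₀ : ℝ≥0, 0 < t₀ → Quantum.IsIrreducibleMap (T.map t₀),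
      ∃ t₀ : ℝ≥0, 0 < t₀ ∧ Quantum.IsIrreducibleMap (T.map t₀),
      T.IsPrimitive ∧ spectrum ℂ T.generator ∩ {z : ℂ | z.re = 0} = {0},
      -- ergodic, with faithful limits
      T.IsErgodic ∧ ∀ η ρ, Quantum.IsDensity η → Quantum.IsDensity ρ → T.RelaxesTo η ρ →
        Quantum.IsFaithful ρ,
      -- ergodic, with one faithful limit for all initial densities
      ∃ ρ, Quantum.IsDensity ρ ∧ Quantum.IsFaithful ρ ∧
        ∀ η, Quantum.IsDensity η → T.RelaxesTo η ρ,
      T.IsPositivityImproving] := by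
  tfae_have 1 → 2 := fun h => QMS.isPrimitive_of_forall_isFaithful fun ρ hρ => h.isFaithful hρ
  tfae_have 2 → 5 := fun h => ⟨h, h.spectrum_inter⟩
  tfae_have 5 → 2 := fun h => h.1
  tfae_have 2 → 7 := fun ⟨ρ, hρ, hf, huniq⟩ =>
    ⟨ρ, hρ.1, hf, fun η hη => hρ.relaxesTo_of_unique hf huniq hη⟩
  tfae_have 7 → 6 := fun ⟨ρ, hρ, hf, h⟩ =>
    ⟨fun η hη => ⟨ρ, hρ, h η hη⟩, fun η σ hη _ hσ => (h η hη).unique hσ ▸ hf⟩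
  tfae_have 6 → 2 := fun h => QMS.isPrimitive_of_forall_isFaithful fun ρ hρ =>
    h.2 ρ ρ hρ.1 hρ.1 hρ.relaxesTo_self
  tfae_have 2 → 8 := fun h => h.isPositivityImproving
  tfae_have 8 → 3 := fun h t₀ ht₀ => h.isIrreducibleMap ht₀
  tfae_have 3 → 4 := fun h => ⟨1, one_pos, h 1 one_pos⟩
  tfae_have 4 → 1 := fun ⟨t₀, _, h⟩ p hp hsub => h p hp (hsub t₀)
  tfae_finish
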